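/- Let $\mathcal X,\mathcal Y$ be finite or countable alphabets. A *channel* $K$ from $\mathcal X$ to $\mathcal Y$ is a Markov kernel assigning to every bi-infinite input sequence $x\in\mathcal X^{\mathbb Z}$ a probability law $\Pr(\,\cdot\mid x)$ on output sequences $y\in\mathcal Y^{\mathbb Z}$. Assume that $K$ is *stationary* (shifting the input shifts the law of the output) and *causal* (the law of the output word $Y_{t:t+L}=Y_t\cdots Y_{t+L-1}$ depends only on the inputs at times $<t+L$). For an input process, i.e. a probability law $\mu$ on $\mathcal X^{\mathbb Z}$, let $\Pr_\mu$ be the law of the joint process $(X,Y)$ with $X\sim\mu$ and $Y\mid X=x\sim\Pr(\,\cdot\mid x)$. Write $\overleftarrow{Z}=(X_t,Y_t)_{t<0}$ for the joint past and $\overrightarrow{X}=(X_t)_{t\ge 0}$, $\overrightarrow{Y}=(Y_t)_{t\ge 0}$ for the futures. *Causal states.* Fix any version of the channel's future morphs, i.e. Markov kernels $\Pr(Y_{0:L}=w\mid X_{0:L}=u,\overleftarrow{Z}=z)$, $L\ge 0$, which for every input sequence $x$ (with $u=x_{0:L}$) are a regular conditional distribution of $Y_{0:L}$ given the past under $\Pr(\,\cdot\mid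 x)$. Two joint pasts $z,z'$ are causally equivalent if $$\Pr(Y_{0:L}=\cdot\mid X_{0:L}=u,\overleftarrow{Z}=z)=\Pr(Y_{0:L}=\cdot\mid X_{0:L}=u,\overleftarrow{Z}=z')\quad\text{for all } L \text{ and all } u\in\mathcal X^L .$$ The equivalence classes are the causal states $\mathcal S$, and $\epsilon$ maps a joint past to its class. *Rivals.* Rival states are given by a measurable map $\eta$ from joint pasts to a measurable space whose points are measurable (the partition of joint pasts into the fibres of $\eta$), with state variable $R=\eta(\overleftarrow{Z})$. For an input process $\mu$, the rival is *prescient* if it is as predictive as the joint past whatever inputs follow the past, i.e. if $$I_\nu[R;\overrightarrow{Y}\mid\overrightarrow{X}]=I_\nu[\overleftarrow{Z};\overrightarrow{Y}\mid\overrightarrow{X}]$$ for every probability law $\nu$ on $\mathcal X^{\mathbb Z}$ under which the input past $(X_t)_{t<0}$ has the same law as under $\mu$ (in particular for $\nu=\mu$). Here $I[\,\cdot\,;\cdot\mid\cdot\,]\in[0,\infty]$ is conditional mutual information. *Statistical complexity.* For an input process $\mu$, the input-dependent statistical complexity $C_\mu(s)\in[0,\infty]$ of a map $s$ of joint pasts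 to states is the Shannon entropy $-\sum_\sigma p_\sigma\log_2 p_\sigma$, $p_\sigma=\Pr_\mu(s(\overleftarrow{Z})=\sigma)$, of the state distribution (and $+\infty$ if the state is not almost surely in a countable set). **Theorem (Minimality).** For every stationary input process $\mu$ and every rival $\eta$ that is prescient for $\mu$, the causal states have no larger input-dependent statistical complexity: $$C_\mu(\epsilon)\le C_\mu(\eta).$$ -/

import Mathlib

open MeasureTheory ProbabilityTheory
open scoped ENNReal

namespace Transducer

/-! ### Sequences, pasts, futures and words

Bi-infinite sequences over an alphabet `A` are functions `ℤ → A`.  A one-sided past is a function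
`ℕ → A` whose `k`-th entry is the symbol at time `-1 - k`; a one-sided future is a function
`ℕ → A` whose `n`-th entry is the symbol at time `n`; a word of length `L` is a function
`Fin L → A`. -/

section Sequences

variable {A : Type*}

/-- The shift on bi-infinite sequences, `(shift x) t = x (t + 1)`. -/
def shift (x : ℤ → A) : ℤ → A := fun t => x (t + 1)

/-- The past of a bi-infinite sequence, up to but not including time `0`. -/
def past (x : ℤ → A) : ℕ → A := fun k => x (-1 - (k : ℤ))

/-- The future of a bi-infinite sequence, from time `0` on. -/
def future (x : ℤ → A) : ℕ → A := fun n => x (n : ℤ)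

/-- The word `x_{t : t + L}` of length `L` starting at time `t`. -/
def word (t : ℤ) (L : ℕ) (x : ℤ → A) : Fin L → A := fun i => x (t + (i : ℤ))

/-- The joint input-output past of an input sequence `x` and an output sequence `y`. -/
def jointPast {X Y : Type*} (x : ℤ → X) (y : ℤ → Y) : ℕ → X × Y :=
  fun k => (past x k, past y k)

variable [MeasurableSpace A]

theorem measurable_shift : Measurable (shift : (ℤ → A) → ℤ → A) := by
  unfold shift; fun_prop

theorem measurable_past : Measurable (past : (ℤ → A) → ℕ → A) := by
  unfold past; fun_prop

theorem measurable_future : Measurable (future : (ℤ → A) → ℕ → A) := by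
  unfold future; fun_prop

theorem measurable_word (t : ℤ) (L : ℕ) : Measurable (word t L : (ℤ → A) → Fin L → A) := by
  unfold word; fun_prop

theorem measurable_jointPast {X Y : Type*} [MeasurableSpace X] [MeasurableSpace Y] :
    Measurable (fun ω : (ℤ → X) × (ℤ → Y) => jointPast ω.1 ω.2) := by
  unfold jointPast past; fun_prop

end Sequences

/-! ### Processes and channels

A process over `A` is a probability measure on `ℤ → A`.  A channel with input alphabet `X` and
output alphabet `Y` is a Markov kernel from `ℤ → X` to `ℤ → Y`: every input sequence `x` is
mapped to an output process `K x`. -/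

section Channels

variable {X Y : Type*} [MeasurableSpace X] [MeasurableSpace Y]

/-- A process is stationary if its law is invariant under time translation. -/
def IsStationaryProcess (μ : Measure (ℤ → X)) : Prop := μ.map shift = μ

/-- A channel is stationary if translating the input translates the law of the output,
for every input sequence. -/
def IsStationaryChannel (K : Kernel (ℤ → X) (ℤ → Y)) : Prop :=
  ∀ x, K (shift x) = (K x).map shift

/-- A channel is causal (anticipation-free) if the law of the output word `y_{t : t + L}` depends
only on the inputs at times before `t + L`. -/
def IsCausalChannel (K : Kernel (ℤ → X) (ℤ → Y)) : Prop :=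
  ∀ (t : ℤ) (L : ℕ) (x x' : ℤ → X), (∀ i < t + (L : ℤ), x i = x' i) →
    (K x).map (word t L) = (K x').map (word t L)

/-- The law of the joint input-output process when the channel `K` is driven by the input
process `μ`. -/
noncomputable def jointProcess (μ : Measure (ℤ → X)) (K : Kernel (ℤ → X) (ℤ → Y)) :
    Measure ((ℤ → X) × (ℤ → Y)) := μ ⊗ₘ K

/-- The law of the joint past when the channel `K` is driven by the input process `μ`. -/
noncomputable def jointPastLaw (μ : Measure (ℤ → X)) (K : Kernel (ℤ → X) (ℤ → Y)) :
    Measure (ℕ → X × Y) := (jointProcess μ K).map (fun ω => jointPast ω.1 ω.2)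

/-! ### Future morphs and causal states -/

/-- A version of the future morphs `P(Y_{0:L} | X_{0:L} = u, past = z)`, for all lengths `L`, of a
causal channel: `cond L (z, u)` is the conditional law of the next `L` outputs given the joint
past `z` and the next `L` inputs `u`.  It is a regular conditional distribution, under every
output process `K x`, of the output word given the past.  (For a causal channel the inputs from
time `L` on do not influence the first `L` outputs, so that these word distributions, for all `L`,
make up the conditional law of the infinite output future given the infinite input future and the
joint past.) -/
structure FutureMorph (K : Kernel (ℤ → X) (ℤ → Y)) where
  /-- The conditional word distributions. -/
  cond : ∀ L : ℕ, Kernel ((ℕ → X × Y) × (Fin L → X)) (Fin L → Y)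
  /-- They are probability distributions. -/
  isMarkovKernel : ∀ L, IsMarkovKernel (cond L)
  /-- They disintegrate the law of past and output word, for each input sequence. -/
  disintegrate : ∀ (L : ℕ) (x : ℤ → X),
    (K x).map (fun y => (jointPast x y, word 0 L y)) =
      (K x).map (jointPast x) ⊗ₘ
        ((cond L).comap (fun z => (z, word 0 L x)) measurable_prodMk_right)

/-- For a causal channel, the law of all outputs before time `L` depends only on the inputs before
time `L`. -/
theorem IsCausalChannel.map_Iio_eq {K : Kernel (ℤ → X) (ℤ → Y)} [IsMarkovKernel K]
    (hK : IsCausalChannel K) (L : ℕ) {x x' : ℤ → X} (h : ∀ i < (L : ℤ), x i = x' i) :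
    (K x).map (fun (y : ℤ → Y) (i : Set.Iio (L : ℤ)) => y i) =
      (K x').map (fun (y : ℤ → Y) (i : Set.Iio (L : ℤ)) => y i) := by
  have hm : Measurable (fun (y : ℤ → Y) (i : Set.Iio (L : ℤ)) => y i) := by fun_prop
  have : IsProbabilityMeasure ((K x').map (fun (y : ℤ → Y) (i : Set.Iio (L : ℤ)) => y i)) :=
    Measure.isProbabilityMeasure_map hm.aemeasurable
  refine IsProjectiveLimit.unique
    (P := fun I => ((K x').map (fun (y : ℤ → Y) (i : Set.Iio (L : ℤ)) => y i)).map I.restrict)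
    (fun I => ?_) (fun I => rfl)
  obtain ⟨t, ht⟩ : ∃ t : ℤ, t ≤ L ∧ ∀ i ∈ I, t ≤ (i : ℤ) := by
    refine ⟨min L (∑ i ∈ I, -|(i : ℤ)|), min_le_left _ _, fun i hi => (min_le_right _ _).trans ?_⟩
    rw [Finset.sum_neg_distrib, neg_le]
    exact (neg_le_abs _).trans (Finset.single_le_sum (f := fun i : Set.Iio (L : ℤ) => |(i : ℤ)|)
      (fun _ _ => abs_nonneg _) hi)
  have key := hK t ((L : ℤ) - t).toNat x x' (fun i hi => h i (by omega))
  have hI : ∀ i : I, ((i : Set.Iio (L : ℤ)) : ℤ) < L ∧ t ≤ ((i : Set.Iio (L : ℤ)) : ℤ) :=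
    fun i => ⟨i.1.2, ht.2 _ i.2⟩
  let g : (Fin ((L : ℤ) - t).toNat → Y) → (I → Y) := fun w i =>
    w ⟨(((i : Set.Iio (L : ℤ)) : ℤ) - t).toNat, by have := hI i; omega⟩
  have hg : Measurable g := by fun_prop
  have e : I.restrict ∘ (fun (y : ℤ → Y) (i : Set.Iio (L : ℤ)) => y i)
      = g ∘ word t ((L : ℤ) - t).toNat := by
    funext y i
    have := hI i
    simp only [Function.comp, Finset.restrict, g, word]
    congr 1
    omega
  change _ = ((K x').map (fun (y : ℤ → Y) (i : Set.Iio (L : ℤ)) => y i)).map I.restrict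
  rw [Measure.map_map (by fun_prop) hm, Measure.map_map (by fun_prop) hm, e,
    ← Measure.map_map hg (measurable_word _ _), key, Measure.map_map hg (measurable_word _ _)]

/-- The input sequence with past `p`, continued by the word `u` and then by `d`. -/
def glue {A : Type*} (d : A) (L : ℕ) (q : (ℕ → A) × (Fin L → A)) : ℤ → A := fun t =>
  if t < 0 then q.1 (-1 - t).toNat else if h : t.toNat < L then q.2 ⟨t.toNat, h⟩ else d

theorem measurable_glue (d : X) (L : ℕ) : Measurable (glue d L) := by
  refine measurable_pi_lambda _ fun t => ?_
  unfold glue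
  split_ifs <;> fun_prop

/-- Every causal channel with countable output alphabet has future morphs. -/
theorem IsCausalChannel.nonempty_futureMorph [Nonempty X] [Nonempty Y] [Countable Y]
    [DiscreteMeasurableSpace Y] {K : Kernel (ℤ → X) (ℤ → Y)} [IsMarkovKernel K]
    (hK : IsCausalChannel K) : Nonempty (FutureMorph K) := by
  obtain ⟨d⟩ := ‹Nonempty X›
  have hpw : ∀ L, Measurable (fun y : ℤ → Y => (past y, word 0 L y)) := fun L =>
    measurable_past.prodMk (measurable_word 0 L)
  let κ : ∀ L, Kernel ((ℕ → X) × (Fin L → X)) ((ℕ → Y) × (Fin L → Y)) := fun L =>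
    (K.comap (glue d L) (measurable_glue d L)).map (fun y => (past y, word 0 L y))
  have : ∀ L, IsMarkovKernel (κ L) := fun L => Kernel.IsMarkovKernel.map _ (hpw L)
  have hc : ∀ L, Measurable (fun q : (ℕ → X × Y) × (Fin L → X) =>
      (((fun k => (q.1 k).1 : ℕ → X), q.2), (fun k => (q.1 k).2 : ℕ → Y))) := by
    intro L; fun_prop
  refine ⟨⟨fun L => (κ L).condKernel.comap _ (hc L), fun L => inferInstance, fun L x => ?_⟩⟩
  have h1 : (K x).map (fun y => (past y, word 0 L y)) = κ L (past x, word 0 L x) := by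
    rw [Kernel.map_apply _ (hpw L), Kernel.comap_apply]
    let g : (Set.Iio (L : ℤ) → Y) → (ℕ → Y) × (Fin L → Y) := fun y =>
      (fun k => y ⟨-1 - (k : ℤ), by simp; omega⟩, fun i => y ⟨0 + (i : ℤ), by simp⟩)
    have hg : Measurable g := by fun_prop
    have e : (fun y : ℤ → Y => (past y, word 0 L y))
      = g ∘ (fun (y : ℤ → Y) (i : Set.Iio (L : ℤ)) => y i) := rfl
    rw [e, ← Measure.map_map hg (by fun_prop), ← Measure.map_map hg (by fun_prop),
      hK.map_Iio_eq L]
    intro i hi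
    unfold glue past word
    split_ifs with h h'
    · simp only; congr 1; omega
    · simp only; congr 1; omega
    · omega
  have h2 : (κ L).fst (past x, word 0 L x) = (K x).map past := by
    rw [Kernel.fst_apply, ← h1, Measure.map_map measurable_fst (hpw L)]; rfl
  have h3 : κ L (past x, word 0 L x) = (K x).map past ⊗ₘ
      ((κ L).condKernel.comap (fun p => ((past x, word 0 L x), p)) measurable_prodMk_left) := by
    conv_lhs => rw [← (κ L).disintegrate (κ L).condKernel]
    rw [Kernel.compProd_apply_eq_compProd_sectR, h2]
    rfl
  have hj : Measurable (fun p : ℕ → Y => (fun k => (past x k, p k) : ℕ → X × Y)) := by fun_prop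
  have hj2 : Measurable (fun p : (ℕ → Y) × (Fin L → Y) =>
      ((fun k => (past x k, p.1 k) : ℕ → X × Y), p.2)) := by fun_prop
  have e1 : (K x).map (fun y => (jointPast x y, word 0 L y)) =
      ((K x).map (fun y => (past y, word 0 L y))).map
        (fun p => ((fun k => (past x k, p.1 k) : ℕ → X × Y), p.2)) := by
    rw [Measure.map_map hj2 (hpw L)]; rfl
  have e2 : (K x).map (jointPast x) = ((K x).map past).map
      (fun p : ℕ → Y => (fun k => (past x k, p k) : ℕ → X × Y)) := by
    rw [Measure.map_map hj measurable_past]; rfl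
  rw [e1, e2, h1, h3]
  have : IsProbabilityMeasure ((K x).map past) :=
    Measure.isProbabilityMeasure_map measurable_past.aemeasurable
  have := Measure.isProbabilityMeasure_map (μ := (K x).map past) hj.aemeasurable
  ext s hs
  rw [Measure.map_apply hj2 hs, Measure.compProd_apply (hj2 hs), Measure.compProd_apply hs,
    lintegral_map (Kernel.measurable_kernel_prodMk_left hs) hj]
  rfl

/-- Causal equivalence of joint pasts: the same output law for every future input. -/
def causalSetoid {K : Kernel (ℤ → X) (ℤ → Y)} (Φ : FutureMorph K) : Setoid (ℕ → X × Y) where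
  r z z' := ∀ (L : ℕ) (u : Fin L → X), Φ.cond L (z, u) = Φ.cond L (z', u)
  iseqv := ⟨fun _ _ _ => rfl, fun h L u => (h L u).symm, fun h h' L u => (h L u).trans (h' L u)⟩

/-- The causal states: the classes of causally equivalent joint pasts. -/
abbrev CausalState {K : Kernel (ℤ → X) (ℤ → Y)} (Φ : FutureMorph K) : Type _ :=
  Quotient (causalSetoid Φ)

/-- The `ε`-map, which takes a joint past to its causal state. -/
def epsilonMap {K : Kernel (ℤ → X) (ℤ → Y)} (Φ : FutureMorph K) :
    (ℕ → X × Y) → CausalState Φ := Quotient.mk (causalSetoid Φ)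

end Channels

/-! ### Entropy, conditional mutual information, prescience -/

section Information

open scoped Classical in
/-- The Shannon entropy (in bits) of the state `s z`, when `z` has law `P`.  It is
`-∑ p log₂ p` over the states if almost surely one of countably many states occurs, and
infinite otherwise. -/
noncomputable def stateEntropy {Z S : Type*} [MeasurableSpace Z] (P : Measure Z) (s : Z → S) :
    ℝ≥0∞ :=
  if ∃ C : Set S, C.Countable ∧ ∀ᵐ z ∂P, s z ∈ C then
    ∑' σ : S, ENNReal.ofReal (Real.negMulLog (P.real (s ⁻¹' {σ})) / Real.log 2)
  else ∞

/-- The conditional mutual information `I[U ; V | W]` (in nats): the Kullback-Leibler divergence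
of the joint law of `((U, W), V)` from `P_{U,W} ⊗ P_{V | W}`. -/
noncomputable def condMutualInfo {Ω A B C : Type*} [MeasurableSpace Ω] [MeasurableSpace A]
    [MeasurableSpace B] [StandardBorelSpace B] [Nonempty B] [MeasurableSpace C]
    (P : Measure Ω) [IsFiniteMeasure P] (U : Ω → A) (V : Ω → B) (W : Ω → C) : ℝ≥0∞ :=
  InformationTheory.klDiv (P.map (fun ω => ((U ω, W ω), V ω)))
    (P.map (fun ω => (U ω, W ω)) ⊗ₘ (condDistrib V W P).prodMkLeft A)

variable {X Y R : Type*} [MeasurableSpace X] [MeasurableSpace Y] [MeasurableSpace R]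

/-- The input-dependent statistical complexity of the states `s`: the entropy of the law that the
input process `μ` induces on them. -/
noncomputable def statComplexity {S : Type*} (μ : Measure (ℤ → X)) (K : Kernel (ℤ → X) (ℤ → Y))
    (s : (ℕ → X × Y) → S) : ℝ≥0∞ := stateEntropy (jointPastLaw μ K) s

variable [Countable Y] [DiscreteMeasurableSpace Y] [Nonempty Y]

/-- The prescience `I[R ; future output | future input]` of the states `η`, when the channel `K`
is driven by `ν`. -/
noncomputable def prescience (ν : Measure (ℤ → X)) [IsProbabilityMeasure ν]
    (K : Kernel (ℤ → X) (ℤ → Y)) [IsMarkovKernel K] (η : (ℕ → X × Y) → R) : ℝ≥0∞ :=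
  haveI : IsFiniteMeasure (jointProcess ν K) :=
    inferInstanceAs (IsFiniteMeasure (ν ⊗ₘ K))
  condMutualInfo (jointProcess ν K) (fun ω => η (jointPast ω.1 ω.2)) (fun ω => future ω.2)
    (fun ω => future ω.1)

/-- The rival states `η` are prescient for the channel `K` with input process `μ`: they are as
predictive as the joint pasts, `I[R ; Y_future | X_future] = I[past ; Y_future | X_future]`,
no matter what inputs the channel is fed from time `0` on, that is, under every input law `ν` that
has the same law of input pasts as `μ` (in particular under `μ` itself). -/
def IsPrescient (μ : Measure (ℤ → X)) (K : Kernel (ℤ → X) (ℤ → Y)) [IsMarkovKernel K]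
    (η : (ℕ → X × Y) → R) : Prop :=
  ∀ (ν : Measure (ℤ → X)) [IsProbabilityMeasure ν], ν.map past = μ.map past →
    prescience ν K η = prescience ν K (id : (ℕ → X × Y) → ℕ → X × Y)

end Information

end Transducer

/-! If the rival has infinite complexity there is nothing to prove. Otherwise fix a word `u` and
drive the channel by the law `fixedFuture`: past as under `μ`, future deterministically `u` followed
by a filler letter. By causality the joint past keeps its law under `μ`. The future input is now
almost surely constant, so conditioning on it is void (`condMutualInfo_of_ae_eq_const`) and
prescience reads I[R; V] = I[Z; V], where Z is the joint past, R = η(Z) and V the output future.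

This common value is finite because R has finite entropy
(`mutualInfo_ne_top_of_stateEntropy_ne_top`). Hence equality in the data processing inequality makes
Z and V conditionally independent given R (`map_eq_compProd_of_mutualInfo_eq`), and on every atom of
R the probability that the future morph of Z assigns to a given word is almost surely constant
(`exists_ae_eq_const_on_atom`).

There are only countably many triples of a length, an input word and an output word, so outside a
single null set an atom of R determines all future morphs, that is, the causal state. So ε(Z) is
almost surely a function of R, and merging states cannot raise entropy (`stateEntropy_le_of_atoms`).
-/

namespace Transducer

/-! ### Mutual information and equality in data processing. -/

section Divergence

variable {Ω A B C D : Type*} [MeasurableSpace Ω] [MeasurableSpace A] [MeasurableSpace B]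
  [MeasurableSpace C] [MeasurableSpace D]

open InformationTheory

/-- The Kullback-Leibler divergence is invariant under measurable maps with a measurable left
inverse. -/
theorem klDiv_map_of_leftInverse {μ ν : Measure A} [IsFiniteMeasure μ] [IsFiniteMeasure ν]
    {f : A → B} {g : B → A} (hf : Measurable f) (hg : Measurable g)
    (h : Function.LeftInverse g f) : klDiv (μ.map f) (ν.map f) = klDiv μ ν := by
  refine le_antisymm (klDiv_map_le _ _ hf) ?_
  have := klDiv_map_le (μ.map f) (ν.map f) hg
  rwa [Measure.map_map hg hf, Measure.map_map hg hf, h.id, Measure.map_id, Measure.map_id] at this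

/-- Conditioning on an almost surely constant variable does not change the mutual information. -/
theorem condMutualInfo_of_ae_eq_const [StandardBorelSpace B] [Nonempty B]
    (P : Measure Ω) [IsProbabilityMeasure P] {U : Ω → A} {V : Ω → B} {W : Ω → C}
    (hU : Measurable U) (hV : Measurable V) {c : C} (hc : ∀ᵐ ω ∂P, W ω = c) :
    condMutualInfo P U V W =
      klDiv (P.map (fun ω => (U ω, V ω))) ((P.map U).prod (P.map V)) := by
  have := Measure.isProbabilityMeasure_map (μ := P) hV.aemeasurable
  have := Measure.isProbabilityMeasure_map (μ := P) hU.aemeasurable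
  have := Measure.isProbabilityMeasure_map (μ := P) (hU.prodMk hV).aemeasurable
  have hemb : Measurable (fun p : A × B => ((p.1, c), p.2)) := by fun_prop
  have hkernel : condDistrib V W P =ᵐ[P.map W] Kernel.const C (P.map V) := by
    refine condDistrib_ae_eq_of_measure_eq_compProd W hV.aemeasurable ?_
    have h1 : P.map (fun ω => (W ω, V ω)) = P.map (fun ω => (c, V ω)) :=
      Measure.map_congr (by filter_upwards [hc] with ω h; rw [h])
    have h2 : P.map W = Measure.dirac c := by
      rw [Measure.map_congr (g := fun _ => c) hc, Measure.map_const]; simp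
    rw [h1, h2, Measure.compProd_const, Measure.dirac_prod,
      Measure.map_map (by fun_prop) hV]
    rfl
  have hUW : P.map (fun ω => (U ω, W ω)) = (P.map U).map (fun a => (a, c)) := by
    rw [Measure.map_map (by fun_prop) hU]
    exact Measure.map_congr (by filter_upwards [hc] with ω h; simp [h])
  have hW : P.map W = (P.map (fun ω => (U ω, W ω))).map Prod.snd := by
    rw [hUW, Measure.map_map (by fun_prop) (by fun_prop)]
    rw [Measure.map_congr (g := fun _ => c) hc]
    simp [Function.comp_def, Measure.map_const]
  have hprod : P.map (fun ω => (U ω, W ω)) ⊗ₘ (condDistrib V W P).prodMkLeft A =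
      ((P.map U).prod (P.map V)).map (fun p : A × B => ((p.1, c), p.2)) := by
    have h1 : (condDistrib V W P).prodMkLeft A =ᵐ[P.map (fun ω => (U ω, W ω))]
        Kernel.const (A × C) (P.map V) := by
      rw [hW] at hkernel
      filter_upwards [ae_of_ae_map (by fun_prop) hkernel] with p hp
      simpa [Kernel.prodMkLeft_apply] using hp
    rw [Measure.compProd_congr h1, Measure.compProd_const, hUW]
    have : (fun p : A × B => ((p.1, c), p.2)) = Prod.map (fun a => (a, c)) id := rfl
    rw [this, ← Measure.map_prod_map _ _ (by fun_prop) measurable_id, Measure.map_id]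
  have hjoint : P.map (fun ω => ((U ω, W ω), V ω)) =
      (P.map (fun ω => (U ω, V ω))).map (fun p : A × B => ((p.1, c), p.2)) := by
    rw [Measure.map_map hemb (hU.prodMk hV)]
    exact Measure.map_congr (by filter_upwards [hc] with ω h; simp [h])
  rw [condMutualInfo, hprod, hjoint]
  exact klDiv_map_of_leftInverse (g := fun q : (A × C) × B => (q.1.1, q.2)) hemb (by fun_prop)
    (fun _ => rfl)

/-- Equality in the data processing inequality: if `g Z` carries as much (finite) information about
`V` as `Z`, then `Z` and `V` are conditionally independent given `g Z`. -/
theorem map_eq_compProd_of_mutualInfo_eq [StandardBorelSpace A] [Nonempty A]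
    (P : Measure Ω) [IsProbabilityMeasure P] {Z : Ω → A} {V : Ω → B} {g : A → C}
    (hZ : Measurable Z) (hV : Measurable V) (hg : Measurable g)
    (h : klDiv (P.map (fun ω => (g (Z ω), V ω))) ((P.map (fun ω => g (Z ω))).prod (P.map V)) =
      klDiv (P.map (fun ω => (Z ω, V ω))) ((P.map Z).prod (P.map V)))
    (hfin : klDiv (P.map (fun ω => (g (Z ω), V ω)))
      ((P.map (fun ω => g (Z ω))).prod (P.map V)) ≠ ∞) :
    P.map (fun ω => ((g (Z ω), V ω), Z ω)) = P.map (fun ω => (g (Z ω), V ω)) ⊗ₘ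
      (condDistrib Z (fun ω => g (Z ω)) P).prodMkRight B := by
  have := Measure.isProbabilityMeasure_map (μ := P) hV.aemeasurable
  have := Measure.isProbabilityMeasure_map (μ := P) hZ.aemeasurable
  have := Measure.isProbabilityMeasure_map (μ := P) (hg.comp hZ).aemeasurable
  have := Measure.isProbabilityMeasure_map (μ := P) (hZ.prodMk hV).aemeasurable
  have := Measure.isProbabilityMeasure_map (μ := P) ((hg.comp hZ).prodMk hV).aemeasurable
  simp only [Function.comp_def] at *
  have hemb : Measurable (fun p : A × B => ((g p.1, p.2), p.1)) := by fun_prop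
  -- Under the product law Z is independent of V, so the conditional law of Z given (g Z, V) is the
  -- one given g Z alone.
  have hM : ((P.map Z).prod (P.map V)).map (fun p : A × B => ((g p.1, p.2), p.1)) =
      ((P.map (fun ω => g (Z ω))).prod (P.map V)) ⊗ₘ
        (condDistrib Z (fun ω => g (Z ω)) P).prodMkRight B := by
    have e := compProd_map_condDistrib (mβ := inferInstance) (X := fun ω => g (Z ω)) (μ := P)
      hZ.aemeasurable
    ext s hs
    rw [Measure.map_apply hemb hs, Measure.prod_apply_symm (hemb hs), Measure.compProd_apply hs,
      lintegral_prod_symm _ (Kernel.measurable_kernel_prodMk_left hs).aemeasurable]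
    refine lintegral_congr fun v => ?_
    have hm : MeasurableSet ((fun q : C × A => ((q.1, v), q.2)) ⁻¹' s) :=
      (by fun_prop : Measurable (fun q : C × A => ((q.1, v), q.2))) hs
    have e2 := congrArg (fun m => m ((fun q : C × A => ((q.1, v), q.2)) ⁻¹' s)) e
    rw [Measure.compProd_apply hm, Measure.map_apply (by fun_prop) hm] at e2
    have hm2 : MeasurableSet
        ((fun x => (x, v)) ⁻¹' ((fun p : A × B => ((g p.1, p.2), p.1)) ⁻¹' s)) :=
      (by fun_prop : Measurable (fun x : A => ((g x, v), x))) hs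
    rw [Measure.map_apply hZ hm2]
    exact e2.symm
  have hP := compProd_map_condDistrib (mβ := inferInstance) (X := fun ω => (g (Z ω), V ω)) (μ := P)
    hZ.aemeasurable
  have hP' : P.map (fun ω => ((g (Z ω), V ω), Z ω)) =
      (P.map (fun ω => (Z ω, V ω))).map (fun p : A × B => ((g p.1, p.2), p.1)) := by
    rw [Measure.map_map hemb (hZ.prodMk hV)]; rfl
  -- Chain rule for the encoding of (Z, V) as ((g Z, V), Z), which loses nothing. The total is the
  -- information of Z and the first term that of g Z; they agree and are finite, so they cancel and
  -- the conditional divergence vanishes.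
  have key := klDiv_compProd_eq_add (P.map (fun ω => (g (Z ω), V ω)))
    ((P.map (fun ω => g (Z ω))).prod (P.map V))
    (condDistrib Z (fun ω => (g (Z ω), V ω)) P)
    ((condDistrib Z (fun ω => g (Z ω)) P).prodMkRight B)
  rw [← hM, hP, hP', klDiv_map_of_leftInverse (g := fun q : (C × B) × A => (q.2, q.1.2)) hemb
    (by fun_prop) (fun _ => rfl), ← h, ← hP', ← hP] at key
  have h0 : klDiv (P.map (fun ω => (g (Z ω), V ω)) ⊗ₘ condDistrib Z (fun ω => (g (Z ω), V ω)) P)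
      (P.map (fun ω => (g (Z ω), V ω)) ⊗ₘ
        (condDistrib Z (fun ω => g (Z ω)) P).prodMkRight B) = 0 :=
    (ENNReal.add_right_inj hfin).1 (key.symm.trans (add_zero _).symm)
  rw [klDiv_eq_zero_iff] at h0
  rw [← hP, h0]

/-- On an atom of `g Z`, if `Z` and `V` are conditionally independent given `g Z`, the conditional
probability of an event in `V` given `Z` is almost surely constant. -/
theorem exists_ae_eq_const_on_atom [StandardBorelSpace A] [Nonempty A] [MeasurableSingletonClass C]
    (P : Measure Ω) [IsProbabilityMeasure P] {Z : Ω → A} {V : Ω → B} {g : A → C}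
    (hZ : Measurable Z) (hV : Measurable V) (hg : Measurable g)
    (h : P.map (fun ω => ((g (Z ω), V ω), Z ω)) = P.map (fun ω => (g (Z ω), V ω)) ⊗ₘ
      (condDistrib Z (fun ω => g (Z ω)) P).prodMkRight B)
    {f : B → D} (hf : Measurable f) {κ : Kernel A D} [IsMarkovKernel κ]
    (hκ : P.map (fun ω => (Z ω, f (V ω))) = P.map Z ⊗ₘ κ)
    {t : Set D} (ht : MeasurableSet t) {r : C} (hr : P.map Z (g ⁻¹' {r}) ≠ 0) :
    ∃ c : ℝ≥0∞, ∀ᵐ z ∂P.map Z, g z = r → κ z t = c := by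
  have := Measure.isProbabilityMeasure_map (μ := P) hZ.aemeasurable
  have hgr : MeasurableSet (g ⁻¹' {r}) := hg (measurableSet_singleton r)
  have hmap : P.map (fun ω => g (Z ω)) {r} = P.map Z (g ⁻¹' {r}) := by
    rw [Measure.map_apply (by fun_prop) (measurableSet_singleton r), Measure.map_apply hZ hgr]
    rfl
  -- At an atom the conditional distribution is the elementary conditional probability.
  have hcd : ∀ s, MeasurableSet s → condDistrib Z (fun ω => g (Z ω)) P r s =
      (P.map Z (g ⁻¹' {r}))⁻¹ * P.map Z (s ∩ g ⁻¹' {r}) := by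
    intro s hs
    rw [condDistrib_apply_of_ne_zero hZ r (by rwa [hmap]), hmap,
      Measure.map_apply (by fun_prop) ((measurableSet_singleton r).prod hs),
      Measure.map_apply hZ (hs.inter hgr)]
    congr 2
    ext ω
    simp [and_comm]
  -- The constant is P(f V ∈ t | g Z = r). It is identified by comparing integrals over all
  -- measurable parts of the atom.
  set c : ℝ≥0∞ := P.map (fun ω => (g (Z ω), V ω)) ({r} ×ˢ (f ⁻¹' t)) *
    (P.map Z (g ⁻¹' {r}))⁻¹ with hc
  refine ⟨c, ?_⟩
  refine (ae_restrict_iff' hgr).1 ?_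
  refine ae_eq_of_forall_setLIntegral_eq_of_sigmaFinite (κ.measurable_coe ht) measurable_const
    fun s hs _ => ?_
  rw [Measure.restrict_restrict hs, lintegral_const, Measure.restrict_apply MeasurableSet.univ,
    Set.univ_inter]
  have h1 : ∫⁻ z in s ∩ g ⁻¹' {r}, κ z t ∂(P.map Z) =
      P.map (fun ω => (Z ω, f (V ω))) ((s ∩ g ⁻¹' {r}) ×ˢ t) := by
    rw [hκ, Measure.compProd_apply_prod (hs.inter hgr) ht]
  have h2 : P.map (fun ω => (Z ω, f (V ω))) ((s ∩ g ⁻¹' {r}) ×ˢ t) =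
      P.map (fun ω => ((g (Z ω), V ω), Z ω)) (({r} ×ˢ (f ⁻¹' t)) ×ˢ s) := by
    rw [Measure.map_apply (by fun_prop) ((hs.inter hgr).prod ht), Measure.map_apply (by fun_prop)
      (((measurableSet_singleton r).prod (hf ht)).prod hs)]
    congr 1
    ext ω
    simp only [Set.mem_preimage, Set.mem_prod, Set.mem_inter_iff, Set.mem_singleton_iff]
    tauto
  have hrt : MeasurableSet ({r} ×ˢ (f ⁻¹' t) : Set (C × B)) :=
    (measurableSet_singleton r).prod (hf ht)
  rw [h1, h2, h, Measure.compProd_apply_prod hrt hs]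
  have h3 : ∀ p ∈ ({r} ×ˢ (f ⁻¹' t) : Set (C × B)),
      (condDistrib Z (fun ω => g (Z ω)) P).prodMkRight B p s =
        (P.map Z (g ⁻¹' {r}))⁻¹ * P.map Z (s ∩ g ⁻¹' {r}) := by
    rintro ⟨a, b⟩ ⟨ha, -⟩
    rw [Set.mem_singleton_iff] at ha
    simp only at ha
    subst ha
    rw [Kernel.prodMkRight_apply]
    exact hcd s hs
  rw [setLIntegral_congr_fun hrt h3, lintegral_const, Measure.restrict_apply MeasurableSet.univ,
    Set.univ_inter, hc]
  ring

end Divergence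

/-! ### Gluing a past to a prescribed future. -/

section Glue

variable {X : Type*}

theorem past_glue (d : X) (L : ℕ) (q : (ℕ → X) × (Fin L → X)) : past (glue d L q) = q.1 := by
  funext k
  have h : (-1 - (k : ℤ)) < 0 := by omega
  simp only [past, glue, h, if_true, sub_sub_cancel, Int.toNat_natCast]

theorem word_glue (d : X) (L : ℕ) (q : (ℕ → X) × (Fin L → X)) :
    word 0 L (glue d L q) = q.2 := by
  funext i
  simp [word, glue]

theorem future_glue (d : X) (L : ℕ) (p p' : ℕ → X) (u : Fin L → X) :
    future (glue d L (p, u)) = future (glue d L (p', u)) := by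
  funext n
  have h : ¬ (n : ℤ) < 0 := by omega
  simp [future, glue, h]

end Glue

/-! ### Driving the channel with a deterministic future input. -/

section Channels

variable {X Y : Type*} [MeasurableSpace X] [MeasurableSpace Y]

/-- For a causal channel, the law of the joint past depends only on the input past. -/
theorem IsCausalChannel.map_jointPast_eq {K : Kernel (ℤ → X) (ℤ → Y)} [IsMarkovKernel K]
    (hK : IsCausalChannel K) {x x' : ℤ → X} (h : past x = past x') :
    (K x).map (jointPast x) = (K x').map (jointPast x') := by
  -- Time i < 0 is entry -1 - i of the past; horizon 0 then covers exactly the outputs before time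
  -- 0.
  have hlt : ∀ i < ((0 : ℕ) : ℤ), x i = x' i := by
    intro i hi
    have := congrFun h (-1 - i).toNat
    simp only [past] at this
    convert this using 2 <;> omega
  have key := hK.map_Iio_eq 0 hlt
  let g : (Set.Iio ((0 : ℕ) : ℤ) → Y) → (ℕ → X × Y) := fun y k =>
    (past x k, y ⟨-1 - (k : ℤ), by simp; omega⟩)
  have hg : Measurable g := by fun_prop
  have hr : Measurable (fun (y : ℤ → Y) (i : Set.Iio ((0 : ℕ) : ℤ)) => y i) := by fun_prop
  have e : jointPast x = g ∘ (fun (y : ℤ → Y) (i : Set.Iio ((0 : ℕ) : ℤ)) => y i) := rfl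
  have e' : jointPast x' = g ∘ (fun (y : ℤ → Y) (i : Set.Iio ((0 : ℕ) : ℤ)) => y i) := by
    rw [← e]; funext y; unfold jointPast; rw [h]
  rw [e', e, ← Measure.map_map hg hr, key, Measure.map_map hg hr]

/-- The input process that has the past of `μ` and then the word `u`, followed by `d` forever. -/
noncomputable def fixedFuture (μ : Measure (ℤ → X)) (d : X) (L : ℕ) (u : Fin L → X) :
    Measure (ℤ → X) :=
  μ.map (fun x => glue d L (past x, u))

theorem measurable_glue_past (d : X) (L : ℕ) (u : Fin L → X) :
    Measurable (fun x : ℤ → X => glue d L (past x, u)) :=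
  (measurable_glue d L).comp (measurable_past.prodMk measurable_const)

instance (μ : Measure (ℤ → X)) [IsProbabilityMeasure μ] (d : X) (L : ℕ) (u : Fin L → X) :
    IsProbabilityMeasure (fixedFuture μ d L u) :=
  Measure.isProbabilityMeasure_map (measurable_glue_past d L u).aemeasurable

instance (μ : Measure (ℤ → X)) [IsProbabilityMeasure μ] (K : Kernel (ℤ → X) (ℤ → Y))
    [IsMarkovKernel K] : IsProbabilityMeasure (jointProcess μ K) :=
  inferInstanceAs (IsProbabilityMeasure (μ ⊗ₘ K))

instance (μ : Measure (ℤ → X)) [IsProbabilityMeasure μ] (K : Kernel (ℤ → X) (ℤ → Y))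
    [IsMarkovKernel K] : IsProbabilityMeasure (jointPastLaw μ K) :=
  Measure.isProbabilityMeasure_map measurable_jointPast.aemeasurable

theorem map_past_fixedFuture (μ : Measure (ℤ → X)) (d : X) (L : ℕ) (u : Fin L → X) :
    (fixedFuture μ d L u).map past = μ.map past := by
  rw [fixedFuture, Measure.map_map measurable_past (measurable_glue_past d L u)]
  congr 1
  funext x
  exact past_glue d L _

/-- The continuation after time 0 does not depend on the past it is glued to, so any past, here the
constant one, can represent it. This is what makes the conditioning on the future input trivial. -/
theorem future_ae_fixedFuture [Countable X] [MeasurableSingletonClass X]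
    (μ : Measure (ℤ → X)) [IsProbabilityMeasure μ] (K : Kernel (ℤ → X) (ℤ → Y))
    [IsMarkovKernel K] (d : X) (L : ℕ) (u : Fin L → X) :
    ∀ᵐ ω ∂(jointProcess (fixedFuture μ d L u) K),
      future ω.1 = future (glue d L (fun _ => d, u)) := by
  have h1 : ∀ᵐ x ∂fixedFuture μ d L u, future x = future (glue d L (fun _ => d, u)) := by
    refine (ae_map_iff (measurable_glue_past d L u).aemeasurable
      (measurable_future (measurableSet_singleton _))).2 ?_
    exact ae_of_all _ fun x => future_glue d L _ _ u
  have h2 : (jointProcess (fixedFuture μ d L u) K).map Prod.fst = fixedFuture μ d L u :=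
    Measure.fst_compProd _ _
  rw [← h2] at h1
  exact ae_of_ae_map measurable_fst.aemeasurable h1

/-- The joint law of past and output word, when the inputs from time `0` on are fixed. -/
theorem map_jointPast_word_fixedFuture {K : Kernel (ℤ → X) (ℤ → Y)} [IsMarkovKernel K]
    (hK : IsCausalChannel K) (Φ : FutureMorph K) (μ : Measure (ℤ → X)) [IsProbabilityMeasure μ]
    (d : X) (L : ℕ) (u : Fin L → X) :
    (jointProcess (fixedFuture μ d L u) K).map
        (fun ω => (jointPast ω.1 ω.2, word 0 L ω.2)) =
      jointPastLaw μ K ⊗ₘ ((Φ.cond L).comap (fun z => (z, u)) measurable_prodMk_right) := by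
  have := Φ.isMarkovKernel L
  have hm : Measurable (fun ω : (ℤ → X) × (ℤ → Y) => (jointPast ω.1 ω.2, word 0 L ω.2)) :=
    measurable_jointPast.prodMk ((measurable_word 0 L).comp measurable_snd)
  have hj : ∀ x : ℤ → X, Measurable (jointPast x : (ℤ → Y) → _) := fun x =>
    measurable_jointPast.comp measurable_prodMk_left
  ext s hs
  have hG := Kernel.measurable_kernel_prodMk_left
    (κ := (Φ.cond L).comap (fun z => (z, u)) measurable_prodMk_right) hs
  rw [Measure.map_apply hm hs, jointProcess, Measure.compProd_apply (hm hs), fixedFuture,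
    lintegral_map (Kernel.measurable_kernel_prodMk_left (hm hs)) (measurable_glue_past d L u),
    Measure.compProd_apply hs, jointPastLaw, lintegral_map hG measurable_jointPast, jointProcess]
  refine Eq.trans (lintegral_congr fun x => ?_)
    (Measure.lintegral_compProd (hG.comp measurable_jointPast)).symm
  -- The disintegration is used at the glued input x', whose next word is `u`; causality then
  -- returns the law of the joint past from x' to x, as both have the same input past.
  set x' := glue d L (past x, u) with hx'
  have h := congrArg (fun m => m s) (Φ.disintegrate L x')
  have hw : word 0 L x' = u := word_glue d L _
  simp only [hw] at h
  have hm' : Measurable (fun y : ℤ → Y => (jointPast x' y, word 0 L y)) :=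
    hm.comp measurable_prodMk_left
  rw [Measure.map_apply hm' hs,
    hK.map_jointPast_eq (x := x') (x' := x) (past_glue d L _)] at h
  have := Measure.isProbabilityMeasure_map (μ := K x) (hj x).aemeasurable
  rw [Measure.compProd_apply hs, lintegral_map hG (hj x)] at h
  exact h

/-- Outputs before time 0 cannot see the altered inputs. Thus null sets and atoms of joint pasts are
the same for every `u`, and the conclusions for different words can be combined. -/
theorem map_jointPast_fixedFuture {K : Kernel (ℤ → X) (ℤ → Y)} [IsMarkovKernel K]
    (hK : IsCausalChannel K) (Φ : FutureMorph K) (μ : Measure (ℤ → X)) [IsProbabilityMeasure μ]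
    (d : X) (L : ℕ) (u : Fin L → X) :
    (jointProcess (fixedFuture μ d L u) K).map (fun ω => jointPast ω.1 ω.2) =
      jointPastLaw μ K := by
  have := Φ.isMarkovKernel L
  have h := congrArg Measure.fst (map_jointPast_word_fixedFuture hK Φ μ d L u)
  have hw : Measurable (fun ω : (ℤ → X) × (ℤ → Y) => word 0 L ω.2) :=
    (measurable_word 0 L).comp measurable_snd
  rwa [Measure.fst_compProd, Measure.fst_map_prodMk hw] at h

end Channels

/-! ### Entropy of states: monotonicity and a bound on information. -/

section Entropy

open InformationTheory

/-- The summand `-p log₂ p` of the entropy, as `p` times the surprisal. -/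
theorem ofReal_negMulLog_div_log_two {p : ℝ≥0∞} (hp : p ≠ ∞) :
    ENNReal.ofReal (Real.negMulLog p.toReal / Real.log 2) =
      p * ENNReal.ofReal (-Real.log p.toReal / Real.log 2) := by
  rw [Real.negMulLog, neg_mul, ← mul_neg, mul_div_assoc, ENNReal.ofReal_mul ENNReal.toReal_nonneg,
    ENNReal.ofReal_toReal hp]

variable {Z R S : Type*} [MeasurableSpace Z] [MeasurableSpace R] [MeasurableSingletonClass R]

/-- If the state `s` is almost surely a function of the state `η`, it has no larger entropy. -/
theorem stateEntropy_le_of_atoms (P : Measure Z) [IsProbabilityMeasure P] {η : Z → R}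
    (hη : Measurable η) {s : Z → S}
    (h : ∀ r, P (η ⁻¹' {r}) ≠ 0 → ∃ σ, ∀ᵐ z ∂P, η z = r → s z = σ) :
    stateEntropy P s ≤ stateEntropy P η := by
  classical
  by_cases hC : ∃ C : Set R, C.Countable ∧ ∀ᵐ z ∂P, η z ∈ C
  swap
  · rw [stateEntropy, stateEntropy, if_neg hC]
    exact le_top
  obtain ⟨C₀, hC₀, hC₀'⟩ := id hC
  -- Null atoms are discarded, since `h` provides a value only on atoms of positive mass.
  set C : Set R := {r ∈ C₀ | P (η ⁻¹' {r}) ≠ 0} with hCdef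
  have hCc : C.Countable := hC₀.mono (Set.sep_subset _ _)
  have hCae : ∀ᵐ z ∂P, η z ∈ C := by
    have : ∀ᵐ z ∂P, ∀ r ∈ {r ∈ C₀ | P (η ⁻¹' {r}) = 0}, η z ≠ r := by
      rw [ae_ball_iff (hC₀.mono (Set.sep_subset _ _))]
      intro r hr
      have := measure_eq_zero_iff_ae_notMem.1 hr.2
      filter_upwards [this] with z hz using hz
    filter_upwards [hC₀', this] with z h1 h2
    exact ⟨h1, fun h0 => h2 _ ⟨h1, h0⟩ rfl⟩
  obtain ⟨z₀, -⟩ := hCae.exists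
  have : Nonempty S := ⟨s z₀⟩
  choose! f hf using fun r (hr : r ∈ C) => h r hr.2
  have hsf : ∀ᵐ z ∂P, s z = f (η z) := by
    have : ∀ᵐ z ∂P, ∀ r ∈ C, η z = r → s z = f r := (ae_ball_iff hCc).2 hf
    filter_upwards [hCae, this] with z h1 h2 using h2 _ h1 rfl
  have hs : ∃ D : Set S, D.Countable ∧ ∀ᵐ z ∂P, s z ∈ D :=
    ⟨f '' C, hCc.image f, by
      filter_upwards [hCae, hsf] with z h1 h2 using h2 ▸ Set.mem_image_of_mem f h1⟩
  rw [stateEntropy, stateEntropy, if_pos hC, if_pos hs]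
  simp only [measureReal_def]
  have hfib : ∀ σ, P (s ⁻¹' {σ}) = ∑' r : ↥(f ⁻¹' {σ} ∩ C), P (η ⁻¹' {(r : R)}) := by
    intro σ
    have h1 : P (s ⁻¹' {σ}) = P (η ⁻¹' (f ⁻¹' {σ} ∩ C)) := by
      -- The fibre of `s` need not be measurable; almost sure equality with a measurable set
      -- suffices.
      refine measure_congr ?_
      filter_upwards [hCae, hsf] with z h1 h2
      refine propext ?_
      change s z = σ ↔ (f (η z) = σ ∧ η z ∈ C)
      rw [h2]
      exact ⟨fun h => ⟨h, h1⟩, fun h => h.1⟩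
    have hcount : (f ⁻¹' {σ} ∩ C).Countable := hCc.mono Set.inter_subset_right
    have h2 : η ⁻¹' (f ⁻¹' {σ} ∩ C) = ⋃ r ∈ f ⁻¹' {σ} ∩ C, η ⁻¹' {r} := by
      ext z; simp
    rw [h1, h2, measure_biUnion hcount ?_ fun r _ => hη (measurableSet_singleton r)]
    intro a _ b _ hab
    exact Disjoint.preimage η (Set.disjoint_singleton.2 hab)
  -- The entropy of η is grouped along the fibres of f. Within a fibre each atom has at most the
  -- mass of the whole fibre, hence at least its surprisal.
  rw [← (Equiv.sigmaFiberEquiv f).tsum_eq, ENNReal.tsum_sigma']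
  refine ENNReal.tsum_le_tsum fun σ => ?_
  rw [ofReal_negMulLog_div_log_two (measure_ne_top _ _)]
  nth_rewrite 1 [hfib σ]
  rw [← ENNReal.tsum_mul_right]
  have hinj : Function.Injective
      (fun r : ↥(f ⁻¹' {σ} ∩ C) => (⟨r.1, r.2.1⟩ : {a // f a = σ})) :=
    fun a b hab => Subtype.ext (congrArg (fun q : {a // f a = σ} => q.1) hab)
  refine le_trans (ENNReal.tsum_le_tsum fun r => ?_) (ENNReal.tsum_comp_le_tsum_of_injective hinj
    fun a => ENNReal.ofReal (Real.negMulLog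
      (P (η ⁻¹' {(Equiv.sigmaFiberEquiv f) ⟨σ, a⟩})).toReal / Real.log 2))
  change _ ≤ ENNReal.ofReal (Real.negMulLog (P (η ⁻¹' {(r : R)})).toReal / Real.log 2)
  rw [ofReal_negMulLog_div_log_two (measure_ne_top _ _)]
  have hr0 : P (η ⁻¹' {(r : R)}) ≠ 0 := r.2.2.2
  have hle : P (η ⁻¹' {(r : R)}) ≤ P (s ⁻¹' {σ}) := by
    rw [hfib σ]; exact ENNReal.le_tsum r
  have hlog : Real.log (P (η ⁻¹' {(r : R)})).toReal ≤ Real.log (P (s ⁻¹' {σ})).toReal :=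
    Real.log_le_log (ENNReal.toReal_pos hr0 (measure_ne_top _ _))
      (ENNReal.toReal_mono (measure_ne_top _ _) hle)
  refine mul_le_mul_right (ENNReal.ofReal_le_ofReal ?_) _
  exact div_le_div_of_nonneg_right (neg_le_neg hlog) (Real.log_nonneg (by norm_num))

variable {Ω B : Type*} [MeasurableSpace Ω] [MeasurableSpace B]

/-- The entropy of a state depends only on the law of the variable it is a function of. -/
theorem stateEntropy_map (P : Measure Ω)
    {f : Ω → Z} (hf : Measurable f) {η : Z → R} (hη : Measurable η) :
    stateEntropy (P.map f) η = stateEntropy P (fun ω => η (f ω)) := by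
  have h1 : ∀ C : Set R, C.Countable →
      ((∀ᵐ z ∂P.map f, η z ∈ C) ↔ ∀ᵐ ω ∂P, η (f ω) ∈ C) := fun C hC =>
    ae_map_iff hf.aemeasurable (hη hC.measurableSet)
  have h2 : (∃ C : Set R, C.Countable ∧ ∀ᵐ z ∂P.map f, η z ∈ C) ↔
      ∃ C : Set R, C.Countable ∧ ∀ᵐ ω ∂P, η (f ω) ∈ C :=
    exists_congr fun C => and_congr_right fun hC => h1 C hC
  have h3 : ∀ r, (P.map f).real (η ⁻¹' {r}) = P.real ((fun ω => η (f ω)) ⁻¹' {r}) := fun r => by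
    rw [measureReal_def, Measure.map_apply hf (hη (measurableSet_singleton r)), measureReal_def]
    rfl
  simp only [stateEntropy, h3]
  split_ifs with ha hb hb
  · rfl
  · exact absurd (h2.1 ha) hb
  · exact absurd (h2.2 hb) ha
  · rfl

/-- A state with finite entropy has finite mutual information with any other variable. -/
theorem mutualInfo_ne_top_of_stateEntropy_ne_top (P : Measure Ω) [IsProbabilityMeasure P]
    {U : Ω → R} {V : Ω → B} (hU : Measurable U) (hV : Measurable V)
    (h : stateEntropy P U ≠ ∞) :
    klDiv (P.map (fun ω => (U ω, V ω))) ((P.map U).prod (P.map V)) ≠ ∞ := by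
  have := Measure.isProbabilityMeasure_map (μ := P) hV.aemeasurable
  have := Measure.isProbabilityMeasure_map (μ := P) hU.aemeasurable
  have := Measure.isProbabilityMeasure_map (μ := P) (hU.prodMk hV).aemeasurable
  set J := P.map (fun ω => (U ω, V ω)) with hJ
  set M := (P.map U).prod (P.map V) with hM
  let p : R → ℝ≥0∞ := fun r => P (U ⁻¹' {r})
  have hC : ∃ C : Set R, C.Countable ∧ ∀ᵐ ω ∂P, U ω ∈ C := by
    by_contra hC
    exact h (by rw [stateEntropy, if_neg hC])
  rw [stateEntropy, if_pos hC] at h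
  obtain ⟨C, hCc, hCae⟩ := hC
  have : Countable C := hCc.to_subtype
  have hatom : ∀ r : R, MeasurableSet (Prod.fst ⁻¹' {r} : Set (R × B)) := fun r =>
    measurable_fst (measurableSet_singleton r)
  have hMatom : ∀ r, M (Prod.fst ⁻¹' {r}) = p r := by
    intro r
    have e : (Prod.fst ⁻¹' {r} : Set (R × B)) = {r} ×ˢ Set.univ := by ext; simp
    rw [e, hM, Measure.prod_prod, measure_univ, mul_one,
      Measure.map_apply hU (measurableSet_singleton r)]
  -- Since P(U = r, V ∈ A) ≤ P(V ∈ A), the joint law has density at most 1 / p(r) over the slice U =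
  -- r.
  have hJM : ∀ r s, MeasurableSet s →
      J (s ∩ Prod.fst ⁻¹' {r}) ≤ (p r)⁻¹ * M (s ∩ Prod.fst ⁻¹' {r}) := by
    intro r s hs
    have hs' : MeasurableSet (Prod.mk r ⁻¹' s) := measurable_prodMk_left hs
    have e : s ∩ Prod.fst ⁻¹' {r} = {r} ×ˢ (Prod.mk r ⁻¹' s) := by
      ext ⟨a, b⟩
      simp only [Set.mem_inter_iff, Set.mem_preimage, Set.mem_singleton_iff, Set.mem_prod]
      constructor
      · rintro ⟨h1, rfl⟩; exact ⟨rfl, h1⟩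
      · rintro ⟨rfl, h1⟩; exact ⟨h1, rfl⟩
    rw [e, hM, Measure.prod_prod, Measure.map_apply hU (measurableSet_singleton r),
      Measure.map_apply hV hs', hJ,
      Measure.map_apply (hU.prodMk hV) ((measurableSet_singleton r).prod hs'), ← mul_assoc]
    change P (U ⁻¹' {r} ∩ V ⁻¹' (Prod.mk r ⁻¹' s)) ≤ (p r)⁻¹ * p r * _
    by_cases hr : p r = 0
    · rw [measure_mono_null Set.inter_subset_left hr]
      exact zero_le
    · rw [ENNReal.inv_mul_cancel hr (measure_ne_top _ _), one_mul]
      exact measure_mono Set.inter_subset_right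
  have hcover : ∀ N : Measure (R × B), N.map Prod.fst = P.map U →
      N.restrict (⋃ r : C, Prod.fst ⁻¹' {(r : R)}) = N := by
    intro N hN
    refine Measure.restrict_eq_self_of_ae_mem ?_
    have h1 : ∀ᵐ r ∂P.map U, r ∈ C := (ae_map_iff hU.aemeasurable hCc.measurableSet).2 hCae
    rw [← hN] at h1
    filter_upwards [ae_of_ae_map measurable_fst.aemeasurable h1] with q hq
    simpa using hq
  have hJfst : J.map Prod.fst = P.map U := by
    rw [hJ, Measure.map_map measurable_fst (hU.prodMk hV)]; rfl
  have hMfst : M.map Prod.fst = P.map U := Measure.fst_prod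
  have hac : J ≪ M := by
    refine Measure.AbsolutelyContinuous.mk fun s hs hs0 => ?_
    rw [← hcover J hJfst, Measure.restrict_apply hs, Set.inter_iUnion, measure_iUnion_null_iff]
    intro r
    by_cases hr : p r = 0
    · refine measure_mono_null Set.inter_subset_right ?_
      rw [← Measure.map_apply measurable_fst (measurableSet_singleton _), hJfst,
        Measure.map_apply hU (measurableSet_singleton _)]
      exact hr
    · refine le_antisymm ((hJM r s hs).trans ?_) zero_le
      rw [measure_mono_null Set.inter_subset_left hs0, mul_zero]
  rw [klDiv_eq_lintegral_klFun_of_ac hac]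
  -- For 0 ≤ t ≤ 1 / p one has t log t + 1 - t ≤ 1 + t log(1 / p). Integration over the slice gives
  -- p + p log(1 / p), and summation gives a bound of 1 plus the entropy; the extra 1 is harmless,
  -- as only finiteness matters.
  have hbound : ∀ r : C, ∫⁻ q in Prod.fst ⁻¹' {(r : R)},
      ENNReal.ofReal (klFun (J.rnDeriv M q).toReal) ∂M ≤
      p r + ENNReal.ofReal (Real.negMulLog (p r).toReal) := by
    intro r
    have hpr : p r ≠ ∞ := measure_ne_top _ _
    by_cases hr : p r = 0
    · rw [Measure.restrict_eq_zero.2 ((hMatom r).trans hr)]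
      simp
    have hf : ∀ᵐ q ∂M.restrict (Prod.fst ⁻¹' {(r : R)}), J.rnDeriv M q ≤ (p r)⁻¹ := by
      refine ae_le_of_forall_setLIntegral_le_of_sigmaFinite (Measure.measurable_rnDeriv _ _)
        fun s hs _ => ?_
      rw [Measure.restrict_restrict hs, lintegral_const, Measure.restrict_apply MeasurableSet.univ,
        Set.univ_inter]
      exact (Measure.setLIntegral_rnDeriv_le _).trans (hJM r s hs)
    calc ∫⁻ q in Prod.fst ⁻¹' {(r : R)}, ENNReal.ofReal (klFun (J.rnDeriv M q).toReal) ∂M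
        ≤ ∫⁻ q in Prod.fst ⁻¹' {(r : R)},
            (1 + J.rnDeriv M q * ENNReal.ofReal (-Real.log (p r).toReal)) ∂M := by
          refine lintegral_mono_ae ?_
          filter_upwards [hf] with q hq
          have htop : J.rnDeriv M q ≠ ∞ := ne_top_of_le_ne_top (ENNReal.inv_ne_top.2 hr) hq
          have ht : (J.rnDeriv M q).toReal ≤ ((p r).toReal)⁻¹ := by
            rw [← ENNReal.toReal_inv]
            exact ENNReal.toReal_mono (ENNReal.inv_ne_top.2 hr) hq
          have h0 : 0 ≤ (J.rnDeriv M q).toReal := ENNReal.toReal_nonneg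
          have hreal : klFun (J.rnDeriv M q).toReal ≤
              1 + (J.rnDeriv M q).toReal * (-Real.log (p r).toReal) := by
            rw [klFun_apply]
            rcases h0.eq_or_lt with h0 | h0
            · simp [← h0]
            · have := mul_le_mul_of_nonneg_left (Real.log_le_log h0 ht) h0.le
              rw [Real.log_inv] at this
              linarith
          refine (ENNReal.ofReal_le_ofReal hreal).trans (ENNReal.ofReal_add_le.trans ?_)
          rw [ENNReal.ofReal_one, ENNReal.ofReal_mul h0, ENNReal.ofReal_toReal htop]
      _ = p r + (∫⁻ q in Prod.fst ⁻¹' {(r : R)}, J.rnDeriv M q ∂M) *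
            ENNReal.ofReal (-Real.log (p r).toReal) := by
          rw [lintegral_add_left measurable_const, lintegral_one,
            Measure.restrict_apply MeasurableSet.univ, Set.univ_inter, hMatom,
            lintegral_mul_const _ (Measure.measurable_rnDeriv _ _)]
      _ ≤ p r + p r * ENNReal.ofReal (-Real.log (p r).toReal) := by
          gcongr
          refine (Measure.setLIntegral_rnDeriv_le _).trans_eq ?_
          rw [← Measure.map_apply measurable_fst (measurableSet_singleton _), hJfst,
            Measure.map_apply hU (measurableSet_singleton _)]
      _ = p r + ENNReal.ofReal (Real.negMulLog (p r).toReal) := by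
          rw [Real.negMulLog, neg_mul, ← mul_neg, ENNReal.ofReal_mul ENNReal.toReal_nonneg,
            ENNReal.ofReal_toReal hpr]
  have hsplit : ∫⁻ q, ENNReal.ofReal (klFun (J.rnDeriv M q).toReal) ∂M =
      ∫⁻ q in ⋃ r : C, Prod.fst ⁻¹' {(r : R)},
        ENNReal.ofReal (klFun (J.rnDeriv M q).toReal) ∂M := by
    rw [hcover M hMfst]
  rw [hsplit]
  refine ne_top_of_le_ne_top ?_ ((lintegral_iUnion_le _ _).trans (ENNReal.tsum_le_tsum hbound))
  rw [ENNReal.tsum_add]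
  refine ENNReal.add_ne_top.2 ⟨?_, ?_⟩
  · have e : ∑' r : C, p r = P (⋃ r : C, U ⁻¹' {(r : R)}) := by
      rw [measure_iUnion ?_ fun r => hU (measurableSet_singleton _)]
      intro a b hab
      exact Disjoint.preimage U (Set.disjoint_singleton.2 fun h => hab (Subtype.ext h))
    rw [e]
    exact measure_ne_top _ _
  · refine ne_top_of_le_ne_top ?_ (ENNReal.tsum_comp_le_tsum_of_injective
      Subtype.val_injective fun r => ENNReal.ofReal (Real.negMulLog (p r).toReal))
    -- Conversion from nats, used for the divergence, to bits, used for the entropy.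
    have e : ∀ r, ENNReal.ofReal (Real.negMulLog (p r).toReal) = ENNReal.ofReal (Real.log 2) *
        ENNReal.ofReal (Real.negMulLog (P.real (U ⁻¹' {r})) / Real.log 2) := by
      intro r
      have h2 : 0 < Real.log 2 := Real.log_pos (by norm_num)
      rw [← ENNReal.ofReal_mul h2.le, mul_div_cancel₀ _ h2.ne']
      rfl
    simp_rw [e]
    rw [ENNReal.tsum_mul_left]
    exact ENNReal.mul_ne_top ENNReal.ofReal_ne_top h

end Entropy

/-! ### Prescience forces constant future morphs on atoms. -/

section Minimality

variable {X Y R : Type*} [Countable X] [MeasurableSpace X] [DiscreteMeasurableSpace X]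
  [Countable Y] [Nonempty Y] [MeasurableSpace Y] [DiscreteMeasurableSpace Y]
  [MeasurableSpace R] [MeasurableSingletonClass R]

/-- Given a prescient state of finite entropy, the future morphs of the past are almost surely
constant on each atom of the state. -/
theorem IsPrescient.exists_cond_ae_eq_const {K : Kernel (ℤ → X) (ℤ → Y)} [IsMarkovKernel K]
    (hK : IsCausalChannel K) (Φ : FutureMorph K) {μ : Measure (ℤ → X)} [IsProbabilityMeasure μ]
    {η : (ℕ → X × Y) → R} (hη : Measurable η) (hpresc : IsPrescient μ K η)
    (hfin : statComplexity μ K η ≠ ∞) (L : ℕ) (u : Fin L → X) (w : Fin L → Y) {r : R}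
    (hr : jointPastLaw μ K (η ⁻¹' {r}) ≠ 0) :
    ∃ c : ℝ≥0∞, ∀ᵐ z ∂jointPastLaw μ K, η z = r → Φ.cond L (z, u) {w} = c := by
  have := Φ.isMarkovKernel L
  obtain ⟨x₀⟩ : Nonempty (ℤ → X) := nonempty_of_isProbabilityMeasure μ
  have : Nonempty (ℕ → X × Y) := ⟨fun _ => (x₀ 0, Classical.arbitrary Y)⟩
  -- The letter filling the inputs after `u` is arbitrary. Prescience under this law, and not only
  -- under `μ`, is what reaches words `u` that `μ` may never produce.
  set ν := fixedFuture μ (x₀ 0) L u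
  set P := jointProcess ν K
  set Z : (ℤ → X) × (ℤ → Y) → (ℕ → X × Y) := fun ω => jointPast ω.1 ω.2
  set V : (ℤ → X) × (ℤ → Y) → (ℕ → Y) := fun ω => future ω.2
  have hZ : Measurable Z := measurable_jointPast
  have hV : Measurable V := measurable_future.comp measurable_snd
  have hPZ : P.map Z = jointPastLaw μ K := map_jointPast_fixedFuture hK Φ μ (x₀ 0) L u
  have hc := future_ae_fixedFuture μ K (x₀ 0) L u
  have heq := hpresc ν (map_past_fixedFuture μ (x₀ 0) L u)
  have e1 := condMutualInfo_of_ae_eq_const P (hη.comp hZ) hV hc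
  have e2 := condMutualInfo_of_ae_eq_const P hZ hV hc
  have heq' := e1.symm.trans (heq.trans e2)
  have hent : stateEntropy P (fun ω => η (Z ω)) ≠ ∞ := by
    rwa [← stateEntropy_map P hZ hη, hPZ]
  have hind := map_eq_compProd_of_mutualInfo_eq P hZ hV hη heq'
    (mutualInfo_ne_top_of_stateEntropy_ne_top P (hη.comp hZ) hV hent)
  have hword : Measurable (fun (y : ℕ → Y) (i : Fin L) => y i) := by fun_prop
  have hκ := map_jointPast_word_fixedFuture hK Φ μ (x₀ 0) L u
  rw [← hPZ] at hκ hr ⊢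
  have hwV : ∀ ω : (ℤ → X) × (ℤ → Y), word 0 L ω.2 = fun i : Fin L => V ω i := by
    intro ω
    funext i
    simp [word, V, future]
  simp only [hwV] at hκ
  exact exists_ae_eq_const_on_atom P hZ hV hη hind hword hκ (measurableSet_singleton w) hr

end Minimality

end Transducer

theorem mainTheorem2 {X Y R : Type*}
    [Countable X] [MeasurableSpace X] [DiscreteMeasurableSpace X]
    [Countable Y] [Nonempty Y] [MeasurableSpace Y] [DiscreteMeasurableSpace Y]
    [MeasurableSpace R] [MeasurableSingletonClass R]
    (K : Kernel (ℤ → X) (ℤ → Y)) [IsMarkovKernel K]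
    (hK_stat : Transducer.IsStationaryChannel K) (hK_causal : Transducer.IsCausalChannel K)
    (Φ : Transducer.FutureMorph K)
    (μ : Measure (ℤ → X)) [IsProbabilityMeasure μ] (hμ : Transducer.IsStationaryProcess μ)
    (η : (ℕ → X × Y) → R) (hη : Measurable η) (hη_presc : Transducer.IsPrescient μ K η) :
    Transducer.statComplexity μ K (Transducer.epsilonMap Φ) ≤
      Transducer.statComplexity μ K η := by
  by_cases hfin : Transducer.statComplexity μ K η = ∞
  · rw [hfin]
    exact le_top
  refine Transducer.stateEntropy_le_of_atoms _ hη fun r hr => ?_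
  choose c hc using fun (L : ℕ) (u : Fin L → X) (w : Fin L → Y) =>
    Transducer.IsPrescient.exists_cond_ae_eq_const hK_causal Φ hη hη_presc hfin L u w hr
  -- Countable alphabets have countably many finite words, so one null set serves all of them.
  have hall : ∀ᵐ z ∂Transducer.jointPastLaw μ K, ∀ (L : ℕ) (u : Fin L → X) (w : Fin L → Y),
      η z = r → Φ.cond L (z, u) {w} = c L u w := by
    simp only [ae_all_iff]
    exact hc
  have hfreq : ∃ᵐ z ∂Transducer.jointPastLaw μ K, η z = r := by
    rwa [frequently_ae_iff]
  -- The atom has positive mass and so contains a past outside the null set; its class is the causal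
  -- state of the whole atom.
  obtain ⟨z₀, hz₀, hz₀'⟩ := (hfreq.and_eventually hall).exists
  refine ⟨Transducer.epsilonMap Φ z₀, ?_⟩
  filter_upwards [hall] with z hz hzr
  -- Laws on the countable set of output words are determined by singletons, so agreement word by
  -- word is causal equivalence.
  refine Quotient.sound fun L u => Measure.ext_of_singleton fun w => ?_
  rw [hz L u w hzr, hz₀' L u w hz₀]
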